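/- For real $a,b$ let $M(a,b)=\{(x,y,z)\in\mathbb{R}^3:\ \lambda_a=1+a(x^2+y^2)>0\}$ with the Riemannian metric $$g_{a,b}=\frac{dx^2+dy^2}{\lambda_a^2}+\Big(dz+\frac b2\,\frac{y\,dx-x\,dy}{\lambda_a}\Big)^2 .$$ For $a<0$, $M(a,0)$ is the product $\mathbb{H}^2(4a)\times\mathbb{R}$ of the hyperbolic plane of curvature $4a$ with the line. A smooth arc-length parametrized curve $\gamma:I\to M$ on an open interval $I\subset\mathbb{R}$, with unit tangent $T=\gamma'$, is called triharmonic if $$\nabla_T^5T+R(\nabla_T^3T,T)T-R(\nabla_T^2T,\nabla_TT)T=0 ,$$ where $\nabla$ is the Levi-Civita connection and $R(X,Y)Z=\nabla_X\nabla_YZ-\nabla_Y\nabla_XZ-\nabla_{[X,Y]}Z$; it is proper if it is not harmonic, that is, if $\nabla_TT$ does not vanish identically. Its curvature is $\kappa=\lVert\nabla_TT\rVert$. (1) For every $a<0$ there is no proper triharmonic curve with constant curvature in $\mathbb{H}^2(4a)\times\mathbb{R}=M(a,0)$. (2) Let $$P_4(\zeta)=4\zeta^4+8b\cos\alpha_0\,\zeta^3+\big(5b^2\cos^2\alpha_0-8(4a-b^2)\sin^4\alpha_0\big)\zeta^2+b\big(b^2-2(4a-b^2)\sin^2\alpha_0\big)\cos\alpha_0\,\zeta-b^2(4a-b^2)\sin^2\alpha_0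 .$$ If $b=0$, then $P_4(\zeta)=4(\zeta^2-8a\sin^4\alpha_0)\zeta^2$ for all real $a$, $\alpha_0$, $\zeta$; and if, with $b=0$, $P_4$ has a root $\zeta>0$ for some $\alpha_0\in(0,\pi)$, then $a>0$. -/

import Mathlib

open scoped BigOperators ContDiff

noncomputable section

namespace TriharmonicCurves

/-! ### Riemannian geometry in a global chart

A Riemannian metric on an open subset of `ℝⁿ` is given by its Gram matrix
`p ↦ (g_{ij}(p))` in the standard coordinates. Tangent vectors are given by their
components in the coordinate frame `∂₁, …, ∂ₙ`. -/

/-- Coordinate matrix of a metric at every point. -/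
abbrev MetricField (n : ℕ) : Type := (Fin n → ℝ) → Matrix (Fin n) (Fin n) ℝ

variable {n : ℕ}

/-- Partial derivative `∂ f / ∂ xᵢ` at `p`. -/
def partialDeriv (i : Fin n) (f : (Fin n → ℝ) → ℝ) (p : Fin n → ℝ) : ℝ :=
  fderiv ℝ f p (Pi.single i 1)

/-- The inner product `⟨X, Y⟩` of two tangent vectors at `p`. -/
def metricInner (g : MetricField n) (p X Y : Fin n → ℝ) : ℝ :=
  ∑ i, ∑ j, g p i j * X i * Y j

/-- Christoffel symbols of the Levi-Civita connection: `∇_{∂ᵢ} ∂ⱼ = ∑ₖ Γᵏᵢⱼ ∂ₖ`, with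
`Γᵏᵢⱼ = ½ ∑ₗ gᵏˡ (∂ᵢ gⱼₗ + ∂ⱼ gᵢₗ - ∂ₗ gᵢⱼ)`. -/
def christoffel (g : MetricField n) (k i j : Fin n) (p : Fin n → ℝ) : ℝ :=
  (1 / 2) * ∑ l, (g p)⁻¹ k l *
    (partialDeriv i (fun q => g q j l) p + partialDeriv j (fun q => g q i l) p
      - partialDeriv l (fun q => g q i j) p)

/-- Components of the curvature tensor: `R(∂ᵢ, ∂ⱼ) ∂ₖ = ∑ₗ riemann g l k i j ∂ₗ`, where
`R(X,Y)Z = ∇_X ∇_Y Z - ∇_Y ∇_X Z - ∇_{[X,Y]} Z`. -/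
def riemann (g : MetricField n) (l k i j : Fin n) (p : Fin n → ℝ) : ℝ :=
  partialDeriv i (christoffel g l j k) p - partialDeriv j (christoffel g l i k) p
    + ∑ m, (christoffel g l i m p * christoffel g m j k p
      - christoffel g l j m p * christoffel g m i k p)

/-- The tangent vector `R(X,Y)Z` at `p`. -/
def curvatureTensor (g : MetricField n) (p X Y Z : Fin n → ℝ) : Fin n → ℝ :=
  fun l => ∑ i, ∑ j, ∑ k, riemann g l k i j p * X i * Y j * Z k

/-! ### Curves -/

/-- Covariant derivative `∇_T V`, with `T = γ'`, of a vector field `V` along a curve `γ`. -/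
def covDeriv (g : MetricField n) (γ V : ℝ → Fin n → ℝ) : ℝ → Fin n → ℝ :=
  fun s k => deriv (fun t => V t k) s
    + ∑ i, ∑ j, christoffel g k i j (γ s) * deriv (fun t => γ t i) s * V s j

/-- `∇_T^m T`, with `T = γ'`; in particular `m = 0` gives `T` itself. -/
def covDerivT (g : MetricField n) (γ : ℝ → Fin n → ℝ) (m : ℕ) : ℝ → Fin n → ℝ :=
  (covDeriv g γ)^[m] (fun s k => deriv (fun t => γ t k) s)

/-- The curvature `κ(s) = ‖∇_T T‖` of a curve. -/
def curveCurvature (g : MetricField n) (γ : ℝ → Fin n → ℝ) (s : ℝ) : ℝ :=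
  Real.sqrt (metricInner g (γ s) (covDerivT g γ 1 s) (covDerivT g γ 1 s))

/-- `τ₃(γ) = ∇_T^5 T + R(∇_T^3 T, T) T - R(∇_T^2 T, ∇_T T) T`. -/
def tritension (g : MetricField n) (γ : ℝ → Fin n → ℝ) (s : ℝ) : Fin n → ℝ :=
  covDerivT g γ 5 s
    + curvatureTensor g (γ s) (covDerivT g γ 3 s) (covDerivT g γ 0 s) (covDerivT g γ 0 s)
    - curvatureTensor g (γ s) (covDerivT g γ 2 s) (covDerivT g γ 1 s) (covDerivT g γ 0 s)

/-- A smooth arc-length parametrized curve `γ : I → M`, where `I ⊆ ℝ` is an open interval and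
`M ⊆ ℝⁿ` carries the metric `g`. (Values of `γ` outside `I` play no role.) -/
structure IsArcLengthCurve (g : MetricField n) (M : Set (Fin n → ℝ)) (I : Set ℝ)
    (γ : ℝ → Fin n → ℝ) : Prop where
  isOpen : IsOpen I
  ordConnected : I.OrdConnected
  smooth : ContDiffOn ℝ ∞ γ I
  mapsTo : Set.MapsTo γ I M
  unitSpeed : ∀ s ∈ I, metricInner g (γ s) (covDerivT g γ 0 s) (covDerivT g γ 0 s) = 1

/-- The curve is triharmonic: it is arc-length parametrized and `τ₃(γ) = 0`. -/
def IsTriharmonic (g : MetricField n) (M : Set (Fin n → ℝ)) (I : Set ℝ)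
    (γ : ℝ → Fin n → ℝ) : Prop :=
  IsArcLengthCurve g M I γ ∧ ∀ s ∈ I, tritension g γ s = 0

/-- The curve is harmonic, i.e. a geodesic: `∇_T T = 0` on `I`. -/
def IsHarmonic (g : MetricField n) (I : Set ℝ) (γ : ℝ → Fin n → ℝ) : Prop :=
  ∀ s ∈ I, covDerivT g γ 1 s = 0

/-- Proper triharmonic: triharmonic and not harmonic. -/
def IsProperTriharmonic (g : MetricField n) (M : Set (Fin n → ℝ)) (I : Set ℝ)
    (γ : ℝ → Fin n → ℝ) : Prop :=
  IsTriharmonic g M I γ ∧ ¬ IsHarmonic g I γ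

/-- The curvature `κ` is constant on `I`. -/
def HasConstantCurvature (g : MetricField n) (I : Set ℝ) (γ : ℝ → Fin n → ℝ) : Prop :=
  ∃ κ₀ : ℝ, ∀ s ∈ I, curveCurvature g γ s = κ₀

/-! ### Bianchi-Cartan-Vranceanu spaces and the product `ℍ²(4a) × ℝ` -/

/-- `λ = 1 + a (x² + y²)`. -/
def bcvFactor (a : ℝ) (p : Fin 3 → ℝ) : ℝ := 1 + a * (p 0 ^ 2 + p 1 ^ 2)

/-- The underlying set `{(x,y,z) : 1 + a (x² + y²) > 0}` of `M(a,b)`. -/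
def bcvSpace (a : ℝ) : Set (Fin 3 → ℝ) := {p | 0 < bcvFactor a p}

/-- The one-form `dz + (b/2) (y dx - x dy) / λ`. -/
def bcvForm (a b : ℝ) (p : Fin 3 → ℝ) : Fin 3 → ℝ :=
  ![b / 2 * (p 1 / bcvFactor a p), -(b / 2 * (p 0 / bcvFactor a p)), 1]

/-- The metric `g_{a,b} = (dx² + dy²) / λ² + (dz + (b/2) (y dx - x dy) / λ)²`. -/
def bcvMetric (a b : ℝ) : MetricField 3 := fun p =>
  Matrix.diagonal ![1 / bcvFactor a p ^ 2, 1 / bcvFactor a p ^ 2, 0]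
    + Matrix.vecMulVec (bcvForm a b p) (bcvForm a b p)

/-- The product metric of `ℍ²(4a) × ℝ`, `a < 0`, on `bcvSpace a` = (Poincaré disc) `× ℝ`:
the metric of `M(a,0)`. The disc `1 + a (x² + y²) > 0` with `(dx² + dy²) / λ²` is the hyperbolic
plane of constant Gaussian curvature `4a`. -/
def hypProdMetric (a : ℝ) : MetricField 3 := bcvMetric a 0

/-- `M(a,0)` carries the product metric `(dx² + dy²) / λ² + dz²`. -/
theorem hypProdMetric_eq (a : ℝ) (p : Fin 3 → ℝ) :
    hypProdMetric a p =
      Matrix.diagonal ![1 / bcvFactor a p ^ 2, 1 / bcvFactor a p ^ 2, 1] := by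
  ext i j
  fin_cases i <;> fin_cases j <;>
    simp [hypProdMetric, bcvMetric, bcvForm, Matrix.vecMulVec]

/-- The quartic `P₄(ζ)` of the triharmonic helices of `M(a,b)` with angle `α`. -/
def helixQuartic (a b α ζ : ℝ) : ℝ :=
  4 * ζ ^ 4 + 8 * b * Real.cos α * ζ ^ 3
    + (5 * b ^ 2 * Real.cos α ^ 2 - 8 * (4 * a - b ^ 2) * Real.sin α ^ 4) * ζ ^ 2
    + b * (b ^ 2 - 2 * (4 * a - b ^ 2) * Real.sin α ^ 2) * Real.cos α * ζ
    - b ^ 2 * (4 * a - b ^ 2) * Real.sin α ^ 2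

end TriharmonicCurves

end

open scoped BigOperators ContDiff

noncomputable section

namespace TriharmonicCurves

/-! In the orthonormal frame `λ∂₁, λ∂₂, ∂₃` along the curve, covariant differentiation is ordinary
differentiation plus a rotation of the horizontal plane (`frameJet_covDerivT`), and curvature acts
on horizontal parts with constant `K = 4a`. Write `k = κ²`.

The curvature terms of `τ₃` are orthogonal to `T`, so `⟨∇⁵T, T⟩ = 0`. Differentiating `|T|² = 1` and
`|∇T|² = k` then forces `|∇²T|²` to be constant and `∇³T = -ρ∇T` with constant `ρ > 0`
(`FrameJet.helix_of_inner_five`), hence `∇⁵T = ρ²∇T`. The vertical component of `τ₃ = 0` makes `∇T`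
and `∇²T` horizontal. Pairing `τ₃` with `∇T` gives `ρ²k - Kρ(∇T ∧ T)² - Kk² = 0`, impossible for `K
< 0` because every term is nonnegative and the first is positive (`FrameJet.not_triharmonic`).

The quartic claims are elementary: at `b = 0` a root `ζ > 0` satisfies `ζ² = 8a sin⁴α`. -/

/-- A function that is constant on an open set has zero derivative there. -/
theorem hasDerivAt_eq_zero_of_const {I : Set ℝ} (hI : IsOpen I) {f : ℝ → ℝ} {f' c s : ℝ}
    (hs : s ∈ I) (hc : ∀ t ∈ I, f t = c) (hf : HasDerivAt f f' s) : f' = 0 := by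
  have h : HasDerivAt f 0 s := (hasDerivAt_const s c).congr_of_eventuallyEq
    (Filter.eventuallyEq_of_mem (hI.mem_nhds hs) hc)
  exact hf.unique h

/-! ### Curves of constant curvature in a moving frame -/

/-- The covariant derivatives `∇_T^m T` along a curve, in a parallel-in-`z` orthonormal frame of a
product of a surface with a line: `φ` is the rotation speed of the horizontal frame. -/
structure FrameJet (I : Set ℝ) (φ : ℝ → ℝ) (u v w : ℕ → ℝ → ℝ) : Prop where
  hu : ∀ m, ∀ s ∈ I, HasDerivAt (u m) (u (m + 1) s - φ s * v m s) s
  hv : ∀ m, ∀ s ∈ I, HasDerivAt (v m) (v (m + 1) s + φ s * u m s) s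
  hw : ∀ m, ∀ s ∈ I, HasDerivAt (w m) (w (m + 1) s) s

/-- Inner product of the `m`-th and the `n`-th derivative. -/
def frameInner (u v w : ℕ → ℝ → ℝ) (m n : ℕ) (s : ℝ) : ℝ :=
  u m s * u n s + v m s * v n s + w m s * w n s

/-- Metric compatibility: the frame rotation is skew, so the `φ` terms cancel. -/
theorem FrameJet.hasDerivAt_inner {I : Set ℝ} {φ : ℝ → ℝ} {u v w : ℕ → ℝ → ℝ}
    (h : FrameJet I φ u v w) (m n : ℕ) {s : ℝ} (hs : s ∈ I) :
    HasDerivAt (frameInner u v w m n)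
      (frameInner u v w (m + 1) n s + frameInner u v w m (n + 1) s) s := by
  have := (((h.hu m s hs).mul (h.hu n s hs)).add ((h.hv m s hs).mul (h.hv n s hs))).add
    ((h.hw m s hs).mul (h.hw n s hs))
  refine this.congr_deriv ?_
  simp only [frameInner]
  ring

/-- A linear relation `∇_T^{m+1} T = c ∇_T^n T` with constant coefficient can be
differentiated. -/
theorem FrameJet.relation_succ {I : Set ℝ} (hI : IsOpen I) {φ : ℝ → ℝ} {u v w : ℕ → ℝ → ℝ}
    (h : FrameJet I φ u v w) {m n : ℕ} {c : ℝ}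
    (hr : ∀ s ∈ I, u m s = c * u n s ∧ v m s = c * v n s ∧ w m s = c * w n s) :
    ∀ s ∈ I, u (m + 1) s = c * u (n + 1) s ∧ v (m + 1) s = c * v (n + 1) s ∧
      w (m + 1) s = c * w (n + 1) s := by
  intro s hs
  obtain ⟨r1, r2, r3⟩ := hr s hs
  have e1 := hasDerivAt_eq_zero_of_const hI hs (c := 0)
    (fun t ht => by simp [(hr t ht).1]) ((h.hu m s hs).sub ((h.hu n s hs).const_mul c))
  have e2 := hasDerivAt_eq_zero_of_const hI hs (c := 0)
    (fun t ht => by simp [(hr t ht).2.1]) ((h.hv m s hs).sub ((h.hv n s hs).const_mul c))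
  have e3 := hasDerivAt_eq_zero_of_const hI hs (c := 0)
    (fun t ht => by simp [(hr t ht).2.2]) ((h.hw m s hs).sub ((h.hw n s hs).const_mul c))
  -- Substituting the relation for the other horizontal component cancels the `φ` terms.
  rw [r2] at e1
  rw [r1] at e2
  exact ⟨by linarith, by linarith, by linarith⟩

/-- If `∇_T^5 T` is orthogonal to `T`, a unit-speed curve of constant nonzero curvature satisfies
`∇_T^3 T = - ρ ∇_T T` with a positive constant `ρ`, and `⟨∇_T^2 T, T⟩ = - κ²`. -/
theorem FrameJet.helix_of_inner_five {I : Set ℝ} (hI : IsOpen I) (hI' : I.OrdConnected)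
    {φ : ℝ → ℝ} {u v w : ℕ → ℝ → ℝ} (h : FrameJet I φ u v w) {k : ℝ} (hk : 0 < k)
    (h00 : ∀ s ∈ I, frameInner u v w 0 0 s = 1) (h11 : ∀ s ∈ I, frameInner u v w 1 1 s = k)
    (h05 : ∀ s ∈ I, frameInner u v w 0 5 s = 0) {s₀ : ℝ} (hs₀ : s₀ ∈ I) :
    (∀ s ∈ I, frameInner u v w 0 1 s = 0 ∧ frameInner u v w 1 2 s = 0 ∧
      frameInner u v w 0 2 s = -k) ∧
    ∃ ρ : ℝ, 0 < ρ ∧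
      ∀ s ∈ I, u 3 s = -ρ * u 1 s ∧ v 3 s = -ρ * v 1 s ∧ w 3 s = -ρ * w 1 s := by
  have comm : ∀ m n s, frameInner u v w m n s = frameInner u v w n m s := fun m n s => by
    simp only [frameInner]; ring
  have h01 : ∀ s ∈ I, frameInner u v w 0 1 s = 0 := fun s hs => by
    have := hasDerivAt_eq_zero_of_const hI hs h00 (h.hasDerivAt_inner 0 0 hs)
    rw [comm (0 + 1) 0] at this
    simp only [zero_add] at this
    linarith
  have h12 : ∀ s ∈ I, frameInner u v w 1 2 s = 0 := fun s hs => by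
    have := hasDerivAt_eq_zero_of_const hI hs h11 (h.hasDerivAt_inner 1 1 hs)
    rw [comm (1 + 1) 1] at this
    norm_num at this
    linarith
  have h02 : ∀ s ∈ I, frameInner u v w 0 2 s = -k := fun s hs => by
    have := hasDerivAt_eq_zero_of_const hI hs h01 (h.hasDerivAt_inner 0 1 hs)
    norm_num at this
    linarith [h11 s hs]
  have h03 : ∀ s ∈ I, frameInner u v w 0 3 s = 0 := fun s hs => by
    have := hasDerivAt_eq_zero_of_const hI hs h02 (h.hasDerivAt_inner 0 2 hs)
    norm_num at this
    linarith [h12 s hs]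
  have h13 : ∀ s ∈ I, frameInner u v w 2 2 s + frameInner u v w 1 3 s = 0 := fun s hs => by
    have := hasDerivAt_eq_zero_of_const hI hs h12 (h.hasDerivAt_inner 1 2 hs)
    norm_num at this
    linarith
  have h04 : ∀ s ∈ I, frameInner u v w 1 3 s + frameInner u v w 0 4 s = 0 := fun s hs => by
    have := hasDerivAt_eq_zero_of_const hI hs h03 (h.hasDerivAt_inner 0 3 hs)
    norm_num at this
    linarith
  -- With `⟨∇⁵T, T⟩ = 0` the two derivatives read `3⟨2,3⟩ + ⟨1,4⟩ = 0` and `⟨2,3⟩ + 2⟨1,4⟩ = 0`, an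
  -- invertible system.
  have h23 : ∀ s ∈ I, frameInner u v w 2 3 s = 0 := fun s hs => by
    have e1 := hasDerivAt_eq_zero_of_const hI hs h13
      ((h.hasDerivAt_inner 2 2 hs).add (h.hasDerivAt_inner 1 3 hs))
    have e2 := hasDerivAt_eq_zero_of_const hI hs h04
      ((h.hasDerivAt_inner 1 3 hs).add (h.hasDerivAt_inner 0 4 hs))
    norm_num at e1 e2
    rw [comm 3 2] at e1
    linarith [h05 s hs]
  obtain ⟨A, hA⟩ : ∃ A, ∀ s ∈ I, frameInner u v w 2 2 s = A := by
    refine ⟨frameInner u v w 2 2 s₀, fun s hs => ?_⟩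
    refine hI.is_const_of_deriv_eq_zero hI'.isPreconnected
      (fun t ht => (h.hasDerivAt_inner 2 2 ht).differentiableAt.differentiableWithinAt)
      (fun t ht => ?_) hs hs₀
    rw [(h.hasDerivAt_inner 2 2 ht).deriv, comm (2 + 1) 2]
    norm_num
    linarith [h23 t ht]
  -- `∇²T + kT` is the part of `∇²T` orthogonal to `T`; its squared norm is `κ²` times the squared
  -- torsion.
  have key : ∀ s ∈ I, (u 2 s + k * u 0 s) ^ 2 + (v 2 s + k * v 0 s) ^ 2
      + (w 2 s + k * w 0 s) ^ 2 = A - k ^ 2 := fun s hs => by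
    have e0 := h00 s hs
    have e2 := h02 s hs
    have e4 := hA s hs
    simp only [frameInner] at e0 e2 e4
    linear_combination e4 + 2 * k * e2 + k ^ 2 * e0
  have hAk : k ^ 2 ≤ A := by
    have := key s₀ hs₀
    nlinarith [sq_nonneg (u 2 s₀ + k * u 0 s₀), sq_nonneg (v 2 s₀ + k * v 0 s₀),
      sq_nonneg (w 2 s₀ + k * w 0 s₀)]
  refine ⟨fun s hs => ⟨h01 s hs, h12 s hs, h02 s hs⟩, A / k,
    div_pos (lt_of_lt_of_le (by positivity) hAk) hk, ?_⟩
  -- Zero torsion: `∇²T = -kT`, to be differentiated once. Otherwise `T, ∇T, ∇²T` form a basis, with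
  -- Gram determinant `k(A - k²)`, and `∇³T + ρ∇T` is orthogonal to all three.
  rcases hAk.eq_or_lt with hEq | hlt
  · have hρ : A / k = k := by rw [← hEq]; field_simp
    rw [hρ]
    refine h.relation_succ hI (m := 2) (n := 0) fun s hs => ?_
    have e := key s hs
    rw [← hEq, sub_self] at e
    have p1 := sq_nonneg (u 2 s + k * u 0 s)
    have p2 := sq_nonneg (v 2 s + k * v 0 s)
    have p3 := sq_nonneg (w 2 s + k * w 0 s)
    have q1 : u 2 s + k * u 0 s = 0 := pow_eq_zero_iff (two_ne_zero) |>.1 (by linarith)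
    have q2 : v 2 s + k * v 0 s = 0 := pow_eq_zero_iff (two_ne_zero) |>.1 (by linarith)
    have q3 : w 2 s + k * w 0 s = 0 := pow_eq_zero_iff (two_ne_zero) |>.1 (by linarith)
    exact ⟨by linarith, by linarith, by linarith⟩
  · intro s hs
    have e00 := h00 s hs
    have e01 := h01 s hs
    have e02 := h02 s hs
    have e11 := h11 s hs
    have e12 := h12 s hs
    have e22 := hA s hs
    set M : Matrix (Fin 3) (Fin 3) ℝ :=
      !![u 0 s, v 0 s, w 0 s; u 1 s, v 1 s, w 1 s; u 2 s, v 2 s, w 2 s] with hM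
    have hG : M * M.transpose = !![1, 0, -k; 0, k, 0; -k, 0, A] := by
      have e10 := e01
      have e20 := e02
      have e21 := e12
      rw [comm] at e10 e20 e21
      simp only [frameInner] at e00 e01 e02 e11 e12 e22 e10 e20 e21
      ext i j
      fin_cases i <;> fin_cases j <;>
        simp [Matrix.mul_apply, Fin.sum_univ_three, *]
    have hdet : M.det ≠ 0 := by
      have e := congrArg Matrix.det hG
      rw [Matrix.det_mul, Matrix.det_transpose,
        Matrix.det_fin_three !![1, 0, -k; 0, k, 0; -k, 0, A]] at e
      simp at e
      intro h0
      rw [h0] at e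
      nlinarith [mul_pos hk (sub_pos.2 hlt)]
    have hker : M.mulVec ![u 3 s + A / k * u 1 s, v 3 s + A / k * v 1 s,
        w 3 s + A / k * w 1 s] = 0 := by
      have e03 := h03 s hs
      have e13 := h13 s hs
      have e23 := h23 s hs
      have hρ : A / k * k = A := by field_simp
      simp only [frameInner] at e01 e11 e12 e03 e13 e22 e23
      ext i
      fin_cases i
      · simp [hM, Matrix.mulVec, dotProduct, Fin.sum_univ_three]
        linear_combination e03 + A / k * e01
      · simp [hM, Matrix.mulVec, dotProduct, Fin.sum_univ_three]
        linear_combination e13 + A / k * e11 + hρ - e22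
      · simp [hM, Matrix.mulVec, dotProduct, Fin.sum_univ_three]
        linear_combination e23 + A / k * e12
    have h0 := Matrix.eq_zero_of_mulVec_eq_zero hdet hker
    have d0 := congrFun h0 0
    have d1 := congrFun h0 1
    have d2 := congrFun h0 2
    simp at d0 d1 d2
    exact ⟨by linarith, by linarith, by linarith⟩

/-- In the product of a surface of constant negative curvature `K` with a line there is no
triharmonic unit-speed curve of constant nonzero curvature. -/
theorem FrameJet.not_triharmonic {I : Set ℝ} (hI : IsOpen I) (hI' : I.OrdConnected)
    {φ : ℝ → ℝ} {u v w : ℕ → ℝ → ℝ} (h : FrameJet I φ u v w) {k K : ℝ} (hk : 0 < k)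
    (hK : K < 0)
    (h00 : ∀ s ∈ I, frameInner u v w 0 0 s = 1) (h11 : ∀ s ∈ I, frameInner u v w 1 1 s = k)
    (hu5 : ∀ s ∈ I, u 5 s + K * (u 3 s * v 0 s - v 3 s * u 0 s) * v 0 s
      - K * (u 2 s * v 1 s - v 2 s * u 1 s) * v 0 s = 0)
    (hv5 : ∀ s ∈ I, v 5 s - K * (u 3 s * v 0 s - v 3 s * u 0 s) * u 0 s
      + K * (u 2 s * v 1 s - v 2 s * u 1 s) * u 0 s = 0)
    (hw5 : ∀ s ∈ I, w 5 s = 0) {s₀ : ℝ} (hs₀ : s₀ ∈ I) : False := by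
  have h05 : ∀ s ∈ I, frameInner u v w 0 5 s = 0 := fun s hs => by
    simp only [frameInner]
    linear_combination u 0 s * hu5 s hs + v 0 s * hv5 s hs + w 0 s * hw5 s hs
  obtain ⟨hin, ρ, hρ, h3⟩ := h.helix_of_inner_five hI hI' hk h00 h11 h05 hs₀
  have h5 := h.relation_succ hI (h.relation_succ hI h3)
  have hw1 : ∀ s ∈ I, w 1 s = 0 := fun s hs => by
    have e := (h5 s hs).2.2
    have e' := (h3 s hs).2.2
    norm_num at e e'
    rw [hw5 s hs, e'] at e
    have : ρ ^ 2 * w 1 s = 0 := by linarith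
    exact (mul_eq_zero.1 this).resolve_left (by positivity)
  have hw2 : w 2 s₀ = 0 := hasDerivAt_eq_zero_of_const hI hs₀ hw1 (h.hw 1 s₀ hs₀)
  obtain ⟨e01, e12, e02⟩ := hin s₀ hs₀
  have e11 := h11 s₀ hs₀
  obtain ⟨a3, b3, -⟩ := h3 s₀ hs₀
  obtain ⟨a5, b5, -⟩ := h5 s₀ hs₀
  norm_num at a5 b5
  have c1 := hu5 s₀ hs₀
  have c2 := hv5 s₀ hs₀
  simp only [frameInner, hw1 s₀ hs₀, hw2] at e01 e12 e02 e11
  rw [a5, a3, b3] at c1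
  rw [b5, a3, b3] at c2
  -- This is `⟨τ₃, ∇T⟩`. The last term comes from Lagrange's identity `(∇²T ∧ ∇T)(∇T ∧ T) =
  -- ⟨∇²T,∇T⟩⟨∇T,T⟩ - ⟨∇²T,T⟩|∇T|² = k²`, valid since `∇T` and `∇²T` are horizontal.
  have main : ρ ^ 2 * k - K * ρ * (u 1 s₀ * v 0 s₀ - v 1 s₀ * u 0 s₀) ^ 2 - K * k ^ 2 = 0 := by
    linear_combination u 1 s₀ * c1 + v 1 s₀ * c2 - ρ ^ 2 * e11
      + K * (u 1 s₀ ^ 2 + v 1 s₀ ^ 2) * (-e02) + K * k * e11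
      + K * (u 2 s₀ * u 1 s₀ + v 2 s₀ * v 1 s₀) * e01
  have : 0 < ρ ^ 2 * k := by positivity
  have : 0 ≤ -K * ρ * (u 1 s₀ * v 0 s₀ - v 1 s₀ * u 0 s₀) ^ 2 :=
    mul_nonneg (mul_nonneg (by linarith) hρ.le) (sq_nonneg _)
  have : 0 < -K * k ^ 2 := mul_pos (by linarith) (by positivity)
  linarith

/-! ### Connection and curvature of the product metric -/

theorem partialDeriv_eq_of_hasFDerivAt {n : ℕ} {f : (Fin n → ℝ) → ℝ} {f' : (Fin n → ℝ) →L[ℝ] ℝ}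
    {p : Fin n → ℝ} (hf : HasFDerivAt f f' p) (i : Fin n) :
    partialDeriv i f p = f' (Pi.single i 1) := by
  rw [partialDeriv, hf.fderiv]

/-- Indicator of the horizontal coordinates. -/
def horiz : Fin 3 → ℝ := ![1, 1, 0]

/-- Kronecker delta. -/
def kron (i j : Fin 3) : ℝ := if i = j then 1 else 0

theorem continuous_bcvFactor (a : ℝ) : Continuous (bcvFactor a) := by
  unfold bcvFactor; fun_prop

theorem contDiff_bcvFactor (a : ℝ) : ContDiff ℝ ∞ (bcvFactor a) := by
  unfold bcvFactor; fun_prop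

theorem partialDeriv_comp_bcvFactor (a : ℝ) (i : Fin 3) {F : ℝ → ℝ} {F' : ℝ} {p : Fin 3 → ℝ}
    (hF : HasDerivAt F F' (bcvFactor a p)) :
    HasFDerivAt (fun q => F (bcvFactor a q)) (fderiv ℝ (fun q => F (bcvFactor a q)) p) p ∧
    partialDeriv i (fun q => F (bcvFactor a q)) p = F' * (2 * a * (horiz i * p i)) := by
  have h0 : HasFDerivAt (fun q : Fin 3 → ℝ => q 0) (ContinuousLinearMap.proj 0 :
    (Fin 3 → ℝ) →L[ℝ] ℝ) p := hasFDerivAt_apply 0 p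
  have h1 : HasFDerivAt (fun q : Fin 3 → ℝ => q 1) (ContinuousLinearMap.proj 1 :
    (Fin 3 → ℝ) →L[ℝ] ℝ) p := hasFDerivAt_apply 1 p
  have hl : HasFDerivAt (bcvFactor a) _ p :=
    (((h0.pow 2).add (h1.pow 2)).const_mul a).const_add 1
  have hc : HasFDerivAt (fun q => F (bcvFactor a q)) _ p := hF.comp_hasFDerivAt p hl
  refine ⟨hc.differentiableAt.hasFDerivAt, ?_⟩
  rw [partialDeriv_eq_of_hasFDerivAt hc i]
  fin_cases i <;> simp [horiz] <;> left <;> ring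

theorem hypProdMetric_apply (a : ℝ) (p : Fin 3 → ℝ) (i j : Fin 3) :
    hypProdMetric a p i j
      = kron i j * (horiz i * (1 / bcvFactor a p ^ 2) + (1 - horiz i)) := by
  rw [hypProdMetric_eq]
  fin_cases i <;> fin_cases j <;> simp [kron, horiz]

theorem partialDeriv_hypProdMetric {a : ℝ} {p : Fin 3 → ℝ} (hp : bcvFactor a p ≠ 0)
    (i j l : Fin 3) :
    partialDeriv i (fun q => hypProdMetric a q j l) p
      = kron j l * horiz j * (-4 * a * (horiz i * p i) / bcvFactor a p ^ 3) := by
  have hF : HasDerivAt (fun x : ℝ => kron j l * (horiz j * (1 / x ^ 2) + (1 - horiz j)))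
      (kron j l * horiz j * (-2 / bcvFactor a p ^ 3)) (bcvFactor a p) := by
    have h := (((((hasDerivAt_id (bcvFactor a p)).pow 2).inv (pow_ne_zero 2 hp)).const_mul
      (horiz j)).add_const (1 - horiz j)).const_mul (kron j l)
    simp only [one_div]
    refine h.congr_deriv ?_
    simp
    field_simp
  simp only [hypProdMetric_apply]
  rw [(partialDeriv_comp_bcvFactor a i hF).2]
  ring

/-- Logarithmic derivative of the conformal factor `1 / λ`. -/
def logGrad (a : ℝ) (i : Fin 3) (p : Fin 3 → ℝ) : ℝ := -2 * a * p i / bcvFactor a p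

theorem hypProdMetric_inv {a : ℝ} {p : Fin 3 → ℝ} (hp : bcvFactor a p ≠ 0) (i j : Fin 3) :
    (hypProdMetric a p)⁻¹ i j
      = kron i j * (horiz i * bcvFactor a p ^ 2 + (1 - horiz i)) := by
  have : (hypProdMetric a p)⁻¹
      = Matrix.diagonal ![bcvFactor a p ^ 2, bcvFactor a p ^ 2, 1] := by
    apply Matrix.inv_eq_left_inv
    rw [hypProdMetric_eq, Matrix.diagonal_mul_diagonal, ← Matrix.diagonal_one]
    congr 1
    ext i
    fin_cases i <;> simp [hp]
  rw [this]
  fin_cases i <;> fin_cases j <;> simp [kron, horiz]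

/-- The usual formula for a conformally flat plane; the `horiz` factors discard the line direction,
where `logGrad` has no geometric meaning. -/
theorem christoffel_hypProdMetric {a : ℝ} {p : Fin 3 → ℝ} (hp : bcvFactor a p ≠ 0)
    (k i j : Fin 3) :
    christoffel (hypProdMetric a) k i j p
      = horiz k * horiz i * horiz j *
        (kron k j * logGrad a i p + kron k i * logGrad a j p - kron i j * logGrad a k p) := by
  simp only [christoffel, partialDeriv_hypProdMetric hp, hypProdMetric_inv hp, logGrad]
  fin_cases k <;> fin_cases i <;> fin_cases j <;>
    simp [kron, horiz] <;> field_simp <;> ring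

theorem differentiableAt_logGrad_and_partialDeriv {a : ℝ} {p : Fin 3 → ℝ} (hp : bcvFactor a p ≠ 0) (i m : Fin 3) :
    DifferentiableAt ℝ (logGrad a i) p ∧
    partialDeriv m (logGrad a i) p = -2 * a * kron m i / bcvFactor a p
      + 4 * a ^ 2 * p i * (horiz m * p m) / bcvFactor a p ^ 2 := by
  have hF : HasDerivAt (fun x : ℝ => x⁻¹) (-(bcvFactor a p ^ 2)⁻¹) (bcvFactor a p) :=
    hasDerivAt_inv hp
  obtain ⟨d1, d2⟩ := partialDeriv_comp_bcvFactor a m hF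
  have h0 : HasFDerivAt (fun q : Fin 3 → ℝ => q i) (ContinuousLinearMap.proj i :
    (Fin 3 → ℝ) →L[ℝ] ℝ) p := hasFDerivAt_apply i p
  have h : HasFDerivAt (logGrad a i) _ p := (h0.const_mul (-2 * a)).mul d1
  refine ⟨h.differentiableAt, ?_⟩
  rw [partialDeriv_eq_of_hasFDerivAt h m]
  rw [partialDeriv] at d2
  simp only [add_apply, smul_apply, d2]
  simp [kron, Pi.single_apply, eq_comm (a := i)]
  split_ifs <;> field_simp <;> ring

theorem partialDeriv_christoffel {a : ℝ} {p : Fin 3 → ℝ} (hp : bcvFactor a p ≠ 0)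
    (m k i j : Fin 3) :
    partialDeriv m (christoffel (hypProdMetric a) k i j) p
      = horiz k * horiz i * horiz j *
        (kron k j * partialDeriv m (logGrad a i) p + kron k i * partialDeriv m (logGrad a j) p
          - kron i j * partialDeriv m (logGrad a k) p) := by
  -- The closed formula needs `λ ≠ 0`, an open condition, so it can be differentiated at `p`.
  have hev : christoffel (hypProdMetric a) k i j =ᶠ[nhds p] fun q => horiz k * horiz i * horiz j *
      (kron k j * logGrad a i q + kron k i * logGrad a j q - kron i j * logGrad a k q) := by
    filter_upwards [(continuous_bcvFactor a).continuousAt.eventually_ne hp] with q hq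
    exact christoffel_hypProdMetric hq k i j
  have d := fun i => (differentiableAt_logGrad_and_partialDeriv hp i m).1.hasFDerivAt
  have h := ((((d i).const_mul (kron k j)).add ((d j).const_mul (kron k i))).sub
    ((d k).const_mul (kron i j))).const_mul (horiz k * horiz i * horiz j)
  rw [partialDeriv_eq_of_hasFDerivAt (h.congr_of_eventuallyEq hev) m]
  simp [partialDeriv]

theorem riemann_hypProdMetric {a : ℝ} {p : Fin 3 → ℝ} (hp : bcvFactor a p ≠ 0)
    (l k i j : Fin 3) :
    riemann (hypProdMetric a) l k i j p
      = 4 * a / bcvFactor a p ^ 2 * (horiz k * horiz i * horiz j *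
        (kron j k * kron l i - kron i k * kron l j)) := by
  have hx : a * (p 0 ^ 2 + p 1 ^ 2) = bcvFactor a p - 1 := by simp [bcvFactor]
  simp only [riemann, partialDeriv_christoffel hp, christoffel_hypProdMetric hp,
    (differentiableAt_logGrad_and_partialDeriv hp _ _).2, logGrad]
  generalize bcvFactor a p = L at *
  have hL : L = 1 + a * (p 0 ^ 2 + p 1 ^ 2) := by linarith
  fin_cases l <;> fin_cases k <;> fin_cases i <;> fin_cases j <;>
    simp [kron, horiz, Fin.sum_univ_three] <;> field_simp <;> (try rw [hL]) <;> ring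

theorem curvatureTensor_hypProdMetric {a : ℝ} {p : Fin 3 → ℝ} (hp : bcvFactor a p ≠ 0)
    (X Y Z : Fin 3 → ℝ) :
    curvatureTensor (hypProdMetric a) p X Y Z
      = ![4 * a / bcvFactor a p ^ 2 * (X 0 * Y 1 - X 1 * Y 0) * Z 1,
          -(4 * a / bcvFactor a p ^ 2 * (X 0 * Y 1 - X 1 * Y 0) * Z 0), 0] := by
  ext l
  simp only [curvatureTensor, riemann_hypProdMetric hp]
  fin_cases l <;> simp [kron, horiz, Fin.sum_univ_three] <;> ring

/-! ### Passage to the orthonormal frame -/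

/-- Rotation speed along `γ` of the orthonormal frame `λ ∂₁, λ ∂₂, ∂₃`. -/
def frameRotation (a : ℝ) (γ : ℝ → Fin 3 → ℝ) (s : ℝ) : ℝ :=
  logGrad a 1 (γ s) * deriv (fun t => γ t 0) s - logGrad a 0 (γ s) * deriv (fun t => γ t 1) s

theorem metricInner_hypProdMetric (a : ℝ) (p X Y : Fin 3 → ℝ) :
    metricInner (hypProdMetric a) p X Y
      = X 0 / bcvFactor a p * (Y 0 / bcvFactor a p) + X 1 / bcvFactor a p * (Y 1 / bcvFactor a p)
        + X 2 * Y 2 := by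
  simp [metricInner, hypProdMetric_apply, Fin.sum_univ_three, kron, horiz]
  ring

theorem covDeriv_hypProdMetric {a : ℝ} {γ V : ℝ → Fin 3 → ℝ} {s : ℝ}
    (hp : bcvFactor a (γ s) ≠ 0) (k : Fin 3) :
    covDeriv (hypProdMetric a) γ V s k = deriv (fun t => V t k) s + ∑ i, ∑ j,
      horiz k * horiz i * horiz j * (kron k j * logGrad a i (γ s) + kron k i * logGrad a j (γ s)
        - kron i j * logGrad a k (γ s)) * deriv (fun t => γ t i) s * V s j := by
  simp only [covDeriv, christoffel_hypProdMetric hp]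

theorem contDiffOn_deriv_of_isOpen {I : Set ℝ} (hI : IsOpen I) {f : ℝ → ℝ}
    (hf : ContDiffOn ℝ ∞ f I) : ContDiffOn ℝ ∞ (deriv f) I :=
  ((contDiffOn_infty_iff_deriv_of_isOpen hI).1 hf).2

theorem contDiffOn_covDeriv {a : ℝ} {I : Set ℝ} (hI : IsOpen I) {γ V : ℝ → Fin 3 → ℝ}
    (hp : ∀ s ∈ I, bcvFactor a (γ s) ≠ 0) (hγ : ContDiffOn ℝ ∞ γ I)
    (hV : ∀ k, ContDiffOn ℝ ∞ (fun s => V s k) I) (k : Fin 3) :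
    ContDiffOn ℝ ∞ (fun s => covDeriv (hypProdMetric a) γ V s k) I := by
  have hγi : ∀ i, ContDiffOn ℝ ∞ (fun s => γ s i) I := contDiffOn_pi.1 hγ
  have hlog : ∀ i, ContDiffOn ℝ ∞ (fun s => logGrad a i (γ s)) I := fun i =>
    (contDiffOn_const.mul (hγi i)).div ((contDiff_bcvFactor a).comp_contDiffOn hγ) hp
  refine ContDiffOn.congr ?_ fun s hs => covDeriv_hypProdMetric (hp s hs) k
  refine (contDiffOn_deriv_of_isOpen hI (hV k)).add
    (ContDiffOn.sum fun i _ => ContDiffOn.sum fun j _ => ?_)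
  exact ((contDiffOn_const.mul (((contDiffOn_const.mul (hlog i)).add
    (contDiffOn_const.mul (hlog j))).sub (contDiffOn_const.mul (hlog k)))).mul
    (contDiffOn_deriv_of_isOpen hI (hγi i))).mul (hV j)

theorem contDiffOn_covDerivT {a : ℝ} {I : Set ℝ} (hI : IsOpen I) {γ : ℝ → Fin 3 → ℝ}
    (hp : ∀ s ∈ I, bcvFactor a (γ s) ≠ 0) (hγ : ContDiffOn ℝ ∞ γ I) (m : ℕ) :
    ∀ k, ContDiffOn ℝ ∞ (fun s => covDerivT (hypProdMetric a) γ m s k) I := by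
  induction m with
  | zero => exact fun k => contDiffOn_deriv_of_isOpen hI (contDiffOn_pi.1 hγ k)
  | succ m ih =>
    intro k
    simp only [covDerivT, Function.iterate_succ_apply']
    exact contDiffOn_covDeriv hI hp hγ ih k

theorem hasDerivAt_bcvFactor_comp {a : ℝ} {γ : ℝ → Fin 3 → ℝ} {s x y : ℝ}
    (h0 : HasDerivAt (fun t => γ t 0) x s) (h1 : HasDerivAt (fun t => γ t 1) y s) :
    HasDerivAt (fun t => bcvFactor a (γ t)) (2 * a * (γ s 0 * x + γ s 1 * y)) s := by
  refine ((((h0.pow 2).add (h1.pow 2)).const_mul a).const_add 1).congr_deriv ?_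
  simp
  ring

/-- Dividing horizontal components by `λ` absorbs the radial part of the Christoffel terms into the
derivative of `λ`; only the rotation remains. -/
theorem frameJet_covDerivT {a : ℝ} {I : Set ℝ} (hI : IsOpen I) {γ : ℝ → Fin 3 → ℝ}
    (hp : ∀ s ∈ I, bcvFactor a (γ s) ≠ 0) (hγ : ContDiffOn ℝ ∞ γ I) :
    FrameJet I (frameRotation a γ)
      (fun m s => covDerivT (hypProdMetric a) γ m s 0 / bcvFactor a (γ s))
      (fun m s => covDerivT (hypProdMetric a) γ m s 1 / bcvFactor a (γ s))
      (fun m s => covDerivT (hypProdMetric a) γ m s 2) := by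
  have hd : ∀ {f : ℝ → ℝ}, ContDiffOn ℝ ∞ f I → ∀ s ∈ I, HasDerivAt f (deriv f s) s :=
    fun hf s hs =>
      ((hf.contDiffAt (hI.mem_nhds hs)).differentiableAt (by simp)).hasDerivAt
  have hV := contDiffOn_covDerivT hI hp hγ
  have hγi := contDiffOn_pi.1 hγ
  have hsucc : ∀ m s, covDerivT (hypProdMetric a) γ (m + 1) s
      = covDeriv (hypProdMetric a) γ (covDerivT (hypProdMetric a) γ m) s := fun m s => by
    simp only [covDerivT, Function.iterate_succ_apply']
  refine ⟨fun m s hs => ?_, fun m s hs => ?_, fun m s hs => ?_⟩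
  · have hl := hp s hs
    refine ((hd (hV m 0) s hs).div
      (hasDerivAt_bcvFactor_comp (hd (hγi 0) s hs) (hd (hγi 1) s hs)) hl).congr_deriv ?_
    rw [hsucc, covDeriv_hypProdMetric hl]
    simp [Fin.sum_univ_three, kron, horiz, frameRotation, logGrad]
    field_simp
    ring
  · have hl := hp s hs
    refine ((hd (hV m 1) s hs).div
      (hasDerivAt_bcvFactor_comp (hd (hγi 0) s hs) (hd (hγi 1) s hs)) hl).congr_deriv ?_
    rw [hsucc, covDeriv_hypProdMetric hl]
    simp [Fin.sum_univ_three, kron, horiz, frameRotation, logGrad]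
    field_simp
    ring
  · refine (hd (hV m 2) s hs).congr_deriv ?_
    rw [hsucc, covDeriv_hypProdMetric (hp s hs)]
    simp [horiz]

/-! ### Nonexistence and the quartic -/

theorem not_isProperTriharmonic_hypProdMetric {a : ℝ} (ha : a < 0) {I : Set ℝ}
    {γ : ℝ → Fin 3 → ℝ} (h : IsProperTriharmonic (hypProdMetric a) (bcvSpace a) I γ)
    (hκ : HasConstantCurvature (hypProdMetric a) I γ) : False := by
  obtain ⟨⟨hc, hτ⟩, hnh⟩ := h
  obtain ⟨κ, hκ⟩ := hκ
  have hp : ∀ s ∈ I, bcvFactor a (γ s) ≠ 0 := fun s hs =>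
    (show 0 < bcvFactor a (γ s) from hc.mapsTo hs).ne'
  have hJ := frameJet_covDerivT hc.isOpen hp hc.smooth
  simp only [IsHarmonic, not_forall] at hnh
  obtain ⟨s₀, hs₀, hne⟩ := hnh
  have hsq : ∀ s ∈ I, metricInner (hypProdMetric a) (γ s) (covDerivT (hypProdMetric a) γ 1 s)
      (covDerivT (hypProdMetric a) γ 1 s) = κ ^ 2 := fun s hs => by
    rw [← hκ s hs, curveCurvature, Real.sq_sqrt]
    rw [metricInner_hypProdMetric]
    nlinarith [mul_self_nonneg (covDerivT (hypProdMetric a) γ 1 s 0 / bcvFactor a (γ s)),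
      mul_self_nonneg (covDerivT (hypProdMetric a) γ 1 s 1 / bcvFactor a (γ s)),
      mul_self_nonneg (covDerivT (hypProdMetric a) γ 1 s 2)]
  have hκpos : 0 < κ ^ 2 := by
    refine lt_of_le_of_ne (sq_nonneg κ) fun h0 => hne ?_
    have e := hsq s₀ hs₀
    rw [metricInner_hypProdMetric, ← h0] at e
    have p0 := mul_self_nonneg (covDerivT (hypProdMetric a) γ 1 s₀ 0 / bcvFactor a (γ s₀))
    have p1 := mul_self_nonneg (covDerivT (hypProdMetric a) γ 1 s₀ 1 / bcvFactor a (γ s₀))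
    have p2 := mul_self_nonneg (covDerivT (hypProdMetric a) γ 1 s₀ 2)
    have q0 := mul_self_eq_zero.1 (le_antisymm (by linarith) p0)
    have q1 := mul_self_eq_zero.1 (le_antisymm (by linarith) p1)
    have q2 := mul_self_eq_zero.1 (le_antisymm (by linarith) p2)
    ext i
    fin_cases i
    · exact (div_eq_zero_iff.1 q0).resolve_right (hp s₀ hs₀)
    · exact (div_eq_zero_iff.1 q1).resolve_right (hp s₀ hs₀)
    · exact q2
  refine hJ.not_triharmonic hc.isOpen hc.ordConnected hκpos (K := 4 * a) (by linarith)
    (fun s hs => ?_) (fun s hs => ?_) (fun s hs => ?_) (fun s hs => ?_) (fun s hs => ?_) hs₀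
  · rw [← hc.unitSpeed s hs, metricInner_hypProdMetric]
    rfl
  · rw [← hsq s hs, metricInner_hypProdMetric]
    rfl
  · have e := congrFun (hτ s hs) 0
    have hl := hp s hs
    simp only [tritension, curvatureTensor_hypProdMetric hl, Pi.add_apply, Pi.sub_apply] at e
    simp at e
    -- Coordinate components are `λ` times frame components, which also turns `4a/λ²` into `K = 4a`.
    rw [← mul_eq_zero_iff_left hl, ← e]
    field_simp
  · have e := congrFun (hτ s hs) 1
    have hl := hp s hs
    simp only [tritension, curvatureTensor_hypProdMetric hl, Pi.add_apply, Pi.sub_apply] at e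
    simp at e
    rw [← mul_eq_zero_iff_left hl, ← e]
    field_simp
    ring
  · have e := congrFun (hτ s hs) 2
    simp only [tritension, curvatureTensor_hypProdMetric (hp s hs), Pi.add_apply,
      Pi.sub_apply] at e
    simpa using e

end TriharmonicCurves

end

theorem mainTheorem11 :
    (∀ a : ℝ, a < 0 →
      ¬ ∃ (I : Set ℝ) (γ : ℝ → Fin 3 → ℝ),
        TriharmonicCurves.IsProperTriharmonic
          (TriharmonicCurves.hypProdMetric a) (TriharmonicCurves.bcvSpace a) I γ ∧
        TriharmonicCurves.HasConstantCurvature (TriharmonicCurves.hypProdMetric a) I γ) ∧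
    (∀ a α ζ : ℝ, TriharmonicCurves.helixQuartic a 0 α ζ
        = 4 * (ζ ^ 2 - 8 * a * Real.sin α ^ 4) * ζ ^ 2) ∧
    (∀ a α ζ : ℝ, α ∈ Set.Ioo 0 Real.pi → 0 < ζ →
        TriharmonicCurves.helixQuartic a 0 α ζ = 0 → 0 < a) := by
  have hq : ∀ a α ζ : ℝ, TriharmonicCurves.helixQuartic a 0 α ζ
      = 4 * (ζ ^ 2 - 8 * a * Real.sin α ^ 4) * ζ ^ 2 := fun a α ζ => by
    simp only [TriharmonicCurves.helixQuartic]
    ring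
  refine ⟨fun a ha => ?_, hq, fun a α ζ _ hζ h => ?_⟩
  · rintro ⟨I, γ, h, hκ⟩
    exact TriharmonicCurves.not_isProperTriharmonic_hypProdMetric ha h hκ
  · rw [hq] at h
    have h1 : ζ ^ 2 - 8 * a * Real.sin α ^ 4 = 0 := by
      rcases mul_eq_zero.1 h with h | h
      · linarith
      · exact absurd h (by positivity)
    by_contra ha
    have h2 : 0 ≤ -a * Real.sin α ^ 4 := mul_nonneg (by linarith) (by positivity)
    have h3 : 0 < ζ ^ 2 := by positivity
    linarith
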